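/- A finite stochastic game $\mathcal G=(V,(V_1,V_2,V_{\mathsf P}),\delta)$ consists of a finite set $V$ of vertices, a partition of $V$ into (possibly empty) sets $V_1,V_2,V_{\mathsf P}$, and a map $\delta:V\times V\to[0,1]$ with $\delta(v,v')\in\{0,1\}$ for $v\in V_1\cup V_2$, with $\delta(v,\cdot)$ a probability distribution for $v\in V_{\mathsf P}$, and with $\mathrm{post}(v)=\{v' : \delta(v,v')>0\}\neq\emptyset$ for every $v\in V$. A vertex $v$ is terminal if $\delta(v,v)=1$ and $\delta(v,v')=0$ for all $v'\ne v$; let $T$ be the set of terminal vertices. A path is an infinite sequence $\omega$ of vertices with $\delta(\omega_k,\omega_{k+1})>0$ for all $k$; $\Diamond T$ is the set of paths that visit $T$. A strategy of Player $i\in\{1,2\}$ is a function $\pi_i:V^*V_i\to\mathcal D(V)$ into the probability distributions on $V$ such that $\pi_i(\hat\omega v)(v')>0$ only if $v'\in\mathrm{post}(v)$. It is deterministic if every $\pi_i(\hat\omega v)$ is a Dirac distribution, and memoryless if $\pi_i(\hat\omega v)=\pi_i(v)$ for all $\hat\omega\in V^*$ and $v\in V_i$. Strategies $\pi_1,\pi_2$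 and an initial vertex $v$ determine a probability measure $\mathbb P^{\pi_1,\pi_2}_{v}$ on the infinite sequences of vertices: the play starts in $v$, and after a history $\hat\omega u$ the next vertex has the law $\pi_i(\hat\omega u)$ if $u\in V_i$, and $\delta(u,\cdot)$ if $u\in V_{\mathsf P}$. A Player 2 strategy $\pi_2$ is fair if for every Player 1 strategy $\pi_1$ and every initial vertex $v$, $\mathbb P^{\pi_1,\pi_2}_{v}$-almost every $\omega$ is a path such that, for every $u\in V_2$ that occurs infinitely often in $\omega$, every vertex of $\mathrm{post}(u)$ occurs infinitely often in $\omega$. **Lemma.** Let $\mathcal G$ be a finite stochastic game, $v\in V$, and $T$ its set of terminal vertices. If $\mathbb P^{\pi_1,\pi_2}_{v}(\Diamond T)<1$ for some Player 1 strategy $\pi_1$ and some fair Player 2 strategy $\pi_2$, then $\mathbb P^{\pi_1',\pi_2'}_{v}(\Diamond T)<1$ for some memoryless and deterministic Player 1 strategy $\pi_1'$ and some fair Player 2 strategy $\pi_2'$. Moreover, $\pi_2'$ can be taken to be the uniform strategy, $\pi_2'(\hat\omega u)(u')=1/\#\mathrm{post}(u)$ for $\hat\omega\in V^*$, $u\in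 V_2$ and $u'\in\mathrm{post}(u)$. -/

import Mathlib

open MeasureTheory ProbabilityTheory
open scoped ENNReal

/-- Who chooses the successor at a vertex: Player 1, Player 2, or chance. A function into this type
is the same thing as a partition of the vertices into three (possibly empty) classes. -/
inductive Owner : Type
  | one
  | two
  | chance

/-- A finite stochastic game on the vertex set `V`. -/
structure StochasticGame (V : Type*) [Fintype V] where
  owner : V → Owner
  δ : V → V → ℝ
  δ_mem : ∀ v v', δ v v' ∈ Set.Icc (0 : ℝ) 1
  δ_player : ∀ v, owner v ≠ Owner.chance → ∀ v', δ v v' = 0 ∨ δ v v' = 1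
  δ_chance : ∀ v, owner v = Owner.chance → ∑ v', δ v v' = 1
  exists_succ : ∀ v, ∃ v', 0 < δ v v'

namespace StochasticGame

variable {V : Type*} [Fintype V] (G : StochasticGame V)

/-- The set of successors of a vertex. -/
def post (v : V) : Set V := {v' | 0 < G.δ v v'}

/-- The set of terminal vertices. -/
def terminal : Set V := {v | G.δ v v = 1 ∧ ∀ v', v' ≠ v → G.δ v v' = 0}

/-- The infinite paths of the game. -/
def paths : Set (ℕ → V) := {ω | ∀ k, 0 < G.δ (ω k) (ω (k + 1))}

/-- The vertices that occur infinitely often in an infinite sequence. -/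
def infOcc (ω : ℕ → V) : Set V := {u | ∀ n, ∃ m, n ≤ m ∧ ω m = u}

/-- The paths that visit the set `T`. -/
def eventually (T : Set V) : Set (ℕ → V) := {ω | ω ∈ G.paths ∧ ∃ i, ω i ∈ T}

/-- The fair plays for Player 2. -/
def fairPlays : Set (ℕ → V) :=
  {ω | ω ∈ G.paths ∧ ∀ u, G.owner u = Owner.two → u ∈ infOcc ω → G.post u ⊆ infOcc ω}

/-- A (randomized, history-dependent) strategy for the player `i`: the sequence `h` followed by the
vertex `v` of that player is sent to a probability distribution `act h v` on the successors
of `v`. -/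
structure Strategy (i : Owner) where
  act : List V → {v : V // G.owner v = i} → PMF V
  act_post : ∀ h v v', 0 < act h v v' → v' ∈ G.post v

variable {G}

/-- Every choice is a Dirac distribution. -/
def Strategy.IsDeterministic {i : Owner} (σ : G.Strategy i) : Prop :=
  ∀ h v, ∃ v', σ.act h v = PMF.pure v'

/-- Choices depend on the current vertex only. -/
def Strategy.IsMemoryless {i : Owner} (σ : G.Strategy i) : Prop :=
  ∀ h v, σ.act h v = σ.act [] v

/-- Every successor of the current vertex is chosen with the same probability. -/
def Strategy.IsUniform {i : Owner} (σ : G.Strategy i) : Prop :=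
  ∀ (h : List V) (v : {v : V // G.owner v = i}) (v' : V), v' ∈ G.post v →
    σ.act h v v' = ((G.post v).ncard : ℝ≥0∞)⁻¹

/-- The distribution `δ(v, ·)` at a chance vertex. -/
noncomputable def chanceDist (G : StochasticGame V) (v : V) (hv : G.owner v = Owner.chance) :
    PMF V :=
  PMF.ofFintype (fun v' => ENNReal.ofReal (G.δ v v')) (by
    rw [← ENNReal.ofReal_sum_of_nonneg (fun v' _ => (G.δ_mem v v').1), G.δ_chance v hv,
      ENNReal.ofReal_one])

/-- The distribution of the next vertex after the history `h` followed by the vertex `v`. -/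
noncomputable def nextDist (σ₁ : G.Strategy Owner.one) (σ₂ : G.Strategy Owner.two)
    (h : List V) (v : V) : PMF V :=
  match hv : G.owner v with
  | Owner.one => σ₁.act h ⟨v, hv⟩
  | Owner.two => σ₂.act h ⟨v, hv⟩
  | Owner.chance => G.chanceDist v hv

variable [MeasurableSpace V] [DiscreteMeasurableSpace V]

/-- The transition kernel from the first `n + 1` vertices `x 0, …, x n` to the next vertex. -/
noncomputable def stepKernel (σ₁ : G.Strategy Owner.one) (σ₂ : G.Strategy Owner.two) (n : ℕ) :
    Kernel (Finset.Iic n → V) V :=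
  Kernel.ofFunOfCountable fun x =>
    (nextDist σ₁ σ₂
      (List.ofFn fun k : Fin n => x ⟨k, Finset.mem_Iic.2 k.isLt.le⟩)
      (x ⟨n, Finset.mem_Iic.2 le_rfl⟩)).toMeasure

instance (σ₁ : G.Strategy Owner.one) (σ₂ : G.Strategy Owner.two) (n : ℕ) :
    IsMarkovKernel (stepKernel σ₁ σ₂ n) :=
  ⟨fun x => by
    change IsProbabilityMeasure (PMF.toMeasure _)
    infer_instance⟩

/-- The law on infinite sequences (with the σ-algebra generated by the cylinders) of the play from
`v` under the strategies `σ₁` and `σ₂`, given by the Ionescu-Tulcea theorem. -/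
noncomputable def playMeasure (σ₁ : G.Strategy Owner.one) (σ₂ : G.Strategy Owner.two) (v : V) :
    Measure (ℕ → V) :=
  Kernel.traj (X := fun _ => V) (stepKernel σ₁ σ₂) 0 (fun _ => v)

/-- Almost-sure fairness of a Player 2 strategy. -/
def IsFair (σ₂ : G.Strategy Owner.two) : Prop :=
  ∀ (σ₁ : G.Strategy Owner.one) (v : V), playMeasure σ₁ σ₂ v G.fairPlays = 1

end StochasticGame

/-! ### One-step laws of the play and conditional Borel–Cantelli -/

namespace StochasticGame

open Filter Preorder

variable {V : Type*} [Fintype V] {G : StochasticGame V}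

/-! The probabilistic hypothesis is used to extract a single play, and the rest is reachability in a
finite graph. Under the given strategies, almost every play is fair and, by the conditional
Borel–Cantelli lemma (`ae_infOcc_of_chance`), also visits infinitely often every successor of a
recurrent chance vertex. Since `T` is missed with positive probability, some such play `ω` from `v`
never meets `T`. Let `C = infOcc ω`. It is nonempty, disjoint from `T`, reachable from `v`, and
contains all successors of its Player 2 and chance vertices and at least one successor of each of
its Player 1 vertices.

A selector `f` can be chosen that keeps Player 1 inside `C` and leaves a path from `v` to `C`
(`exists_selector_reaching`). Against the uniform strategy every edge of the graph restricted by `f`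
has positive probability, so `C` is reached with positive probability and then never left
(`playMeasure_eventually_terminal_lt_one`). The uniform strategy is fair by the same Borel–Cantelli
argument. -/

theorem nextDist_one (σ₁ : G.Strategy Owner.one) (σ₂ : G.Strategy Owner.two) (h : List V) {v : V}
    (hv : G.owner v = Owner.one) : nextDist σ₁ σ₂ h v = σ₁.act h ⟨v, hv⟩ := by
  unfold nextDist
  split <;> first | rfl | (rename_i h; rw [hv] at h; cases h)

theorem nextDist_two (σ₁ : G.Strategy Owner.one) (σ₂ : G.Strategy Owner.two) (h : List V) {v : V}
    (hv : G.owner v = Owner.two) : nextDist σ₁ σ₂ h v = σ₂.act h ⟨v, hv⟩ := by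
  unfold nextDist
  split <;> first | rfl | (rename_i h; rw [hv] at h; cases h)

theorem nextDist_chance (σ₁ : G.Strategy Owner.one) (σ₂ : G.Strategy Owner.two) (h : List V) {v : V}
    (hv : G.owner v = Owner.chance) : nextDist σ₁ σ₂ h v = G.chanceDist v hv := by
  unfold nextDist
  split <;> first | rfl | (rename_i h; rw [hv] at h; cases h)

theorem nextDist_chance_apply (σ₁ : G.Strategy Owner.one) (σ₂ : G.Strategy Owner.two)
    (h : List V) {v : V} (hv : G.owner v = Owner.chance) (w : V) :
    nextDist σ₁ σ₂ h v w = ENNReal.ofReal (G.δ v w) := by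
  rw [nextDist_chance _ _ _ hv]
  rfl

/-- Every vertex chosen with positive probability is a successor. -/
theorem mem_post_of_nextDist_ne_zero {σ₁ : G.Strategy Owner.one} {σ₂ : G.Strategy Owner.two}
    {h : List V} {v w : V} (hw : nextDist σ₁ σ₂ h v w ≠ 0) : w ∈ G.post v := by
  match hv : G.owner v with
  | Owner.one =>
    rw [nextDist_one _ _ _ hv] at hw
    exact σ₁.act_post h ⟨v, hv⟩ w (pos_iff_ne_zero.2 hw)
  | Owner.two =>
    rw [nextDist_two _ _ _ hv] at hw
    exact σ₂.act_post h ⟨v, hv⟩ w (pos_iff_ne_zero.2 hw)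
  | Owner.chance =>
    rw [nextDist_chance_apply _ _ _ hv] at hw
    exact ENNReal.ofReal_pos.1 (pos_iff_ne_zero.2 hw)

/-- The conditional distribution of the vertex at time `n + 1` given the first `n + 1` vertices
of `ω`. -/
noncomputable def stepDist (σ₁ : G.Strategy Owner.one) (σ₂ : G.Strategy Owner.two) (n : ℕ)
    (ω : ℕ → V) : PMF V :=
  nextDist σ₁ σ₂ (List.ofFn fun k : Fin n => ω k) (ω n)

variable [MeasurableSpace V] [DiscreteMeasurableSpace V]

instance (σ₁ : G.Strategy Owner.one) (σ₂ : G.Strategy Owner.two) (v : V) :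
    IsProbabilityMeasure (playMeasure σ₁ σ₂ v) := by
  unfold playMeasure
  infer_instance

theorem stepKernel_frestrictLe (σ₁ : G.Strategy Owner.one) (σ₂ : G.Strategy Owner.two) (n : ℕ)
    (ω : ℕ → V) :
    stepKernel σ₁ σ₂ n (frestrictLe (π := fun _ => V) n ω) = (stepDist σ₁ σ₂ n ω).toMeasure :=
  rfl

theorem ae_zero_eq (σ₁ : G.Strategy Owner.one) (σ₂ : G.Strategy Owner.two) (v : V) :
    ∀ᵐ ω ∂playMeasure σ₁ σ₂ v, ω 0 = v := by
  have h : ∀ᵐ x ∂(playMeasure σ₁ σ₂ v).map (frestrictLe (π := fun _ => V) 0),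
      x ⟨0, Finset.mem_Iic.2 le_rfl⟩ = v := by
    rw [playMeasure, Kernel.traj_map_frestrictLe_apply, Kernel.partialTraj_self, Kernel.id_apply,
      ae_dirac_eq]
    exact rfl
  exact ae_of_ae_map (by fun_prop) h

theorem ae_toMeasure_iff {V : Type*} [MeasurableSpace V] [DiscreteMeasurableSpace V] {p : PMF V} {q : V → Prop} :
    (∀ᵐ w ∂p.toMeasure, q w) ↔ ∀ w, p w ≠ 0 → q w := by
  rw [ae_iff, PMF.toMeasure_apply_eq_zero_iff _ (MeasurableSet.of_discrete), Set.disjoint_left]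
  simp [PMF.mem_support_iff]

/-- A property of a step of the play holds almost surely iff, almost surely, it holds for all the
choices of positive probability. -/
theorem ae_succ_iff (σ₁ : G.Strategy Owner.one) (σ₂ : G.Strategy Owner.two) (v : V) (n : ℕ)
    (q : (Finset.Iic n → V) → V → Prop) :
    (∀ᵐ ω ∂playMeasure σ₁ σ₂ v, q (frestrictLe (π := fun _ => V) n ω) (ω (n + 1))) ↔
      ∀ᵐ ω ∂playMeasure σ₁ σ₂ v, ∀ w, stepDist σ₁ σ₂ n ω w ≠ 0 →
        q (frestrictLe (π := fun _ => V) n ω) w := by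
  have hq : MeasurableSet {x : (Finset.Iic n → V) × V | q x.1 x.2} :=
    (Set.toFinite _).measurableSet
  have h := Kernel.partialTraj_compProd_eq_map_traj (X := fun _ => V) (κ := stepKernel σ₁ σ₂)
    (Nat.zero_le n) (x₀ := fun _ => v)
  have h₁ : (∀ᵐ ω ∂playMeasure σ₁ σ₂ v, q (frestrictLe (π := fun _ => V) n ω) (ω (n + 1))) ↔
      ∀ᵐ x ∂(Kernel.partialTraj (X := fun _ => V) (stepKernel σ₁ σ₂) 0 n (fun _ => v)) ⊗ₘ
        (stepKernel σ₁ σ₂ n), q x.1 x.2 := by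
    rw [h, ae_map_iff (by fun_prop) hq]
    rfl
  rw [h₁, Measure.ae_compProd_iff hq, ← Kernel.traj_map_frestrictLe_apply,
    ae_map_iff (by fun_prop) (Set.toFinite _).measurableSet]
  refine eventually_congr (Eventually.of_forall fun ω => ?_)
  rw [stepKernel_frestrictLe, ae_toMeasure_iff]

/-- Almost surely, every step has positive probability. -/
theorem ae_stepDist_ne_zero (σ₁ : G.Strategy Owner.one) (σ₂ : G.Strategy Owner.two) (v : V) :
    ∀ᵐ ω ∂playMeasure σ₁ σ₂ v, ∀ n, stepDist σ₁ σ₂ n ω (ω (n + 1)) ≠ 0 := by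
  refine ae_all_iff.2 fun n => ?_
  have h := (ae_succ_iff σ₁ σ₂ v n fun x w => nextDist σ₁ σ₂
      (List.ofFn fun k : Fin n => x ⟨k, Finset.mem_Iic.2 k.isLt.le⟩)
      (x ⟨n, Finset.mem_Iic.2 le_rfl⟩) w ≠ 0).2 (Eventually.of_forall fun ω w hw => hw)
  exact h

theorem ae_mem_paths (σ₁ : G.Strategy Owner.one) (σ₂ : G.Strategy Owner.two) (v : V) :
    ∀ᵐ ω ∂playMeasure σ₁ σ₂ v, ω ∈ G.paths := by
  filter_upwards [ae_stepDist_ne_zero σ₁ σ₂ v] with ω hω k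
  exact mem_post_of_nextDist_ne_zero (hω k)

/-- If the vertex `u` has positive probability at time `n`, and `w` is chosen with positive
probability after every history ending in `u`, then `w` has positive probability at time `n + 1`. -/
theorem playMeasure_succ_ne_zero (σ₁ : G.Strategy Owner.one) (σ₂ : G.Strategy Owner.two) (v : V)
    {n : ℕ} {u w : V} (hu : playMeasure σ₁ σ₂ v {ω | ω n = u} ≠ 0)
    (hw : ∀ h, nextDist σ₁ σ₂ h u w ≠ 0) :
    playMeasure σ₁ σ₂ v {ω | ω (n + 1) = w} ≠ 0 := by
  contrapose! hu
  have h : ∀ᵐ ω ∂playMeasure σ₁ σ₂ v, ω (n + 1) ≠ w := by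
    rw [ae_iff]
    simpa using hu
  have h' := (ae_succ_iff σ₁ σ₂ v n fun _ x => x ≠ w).1 h
  have h'' : ∀ᵐ ω ∂playMeasure σ₁ σ₂ v, ω n ≠ u := by
    filter_upwards [h'] with ω hω hn
    refine hω w ?_ rfl
    unfold stepDist
    rw [hn]
    exact hw _
  rw [ae_iff] at h''
  simpa using h''

/-- Conditioning on the first `n + 1` vertices amounts to restarting the trajectory kernel at time
`n`, and its marginal at time `n + 1` is the step kernel. This supplies the terms of the series in
Lévy's Borel–Cantelli lemma. -/
theorem condExp_indicator_succ (σ₁ : G.Strategy Owner.one) (σ₂ : G.Strategy Owner.two) (v : V)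
    (n : ℕ) (w : V) :
    (playMeasure σ₁ σ₂ v)[({ω | ω (n + 1) = w} : Set (ℕ → V)).indicator (1 : (ℕ → V) → ℝ) |
        Filtration.piLE (X := fun _ => V) n] =ᵐ[playMeasure σ₁ σ₂ v]
      fun ω => (stepDist σ₁ σ₂ n ω w).toReal := by
  have hm : MeasurableSet ({ω | ω (n + 1) = w} : Set (ℕ → V)) :=
    (measurable_pi_apply (X := fun _ : ℕ => V) (n + 1)) (measurableSet_singleton w)
  have h := Kernel.condExp_traj (X := fun _ => V) (κ := stepKernel σ₁ σ₂) (Nat.zero_le n)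
    (x₀ := fun _ => v) (f := ({ω | ω (n + 1) = w} : Set (ℕ → V)).indicator (1 : (ℕ → V) → ℝ))
    ((integrable_const (1 : ℝ)).indicator hm)
  refine h.trans (Eventually.of_forall fun ω => ?_)
  have h₁ := Kernel.map_traj_succ_self (X := fun _ => V) (κ := stepKernel σ₁ σ₂) (a := n)
  have h₂ : Kernel.traj (X := fun _ => V) (stepKernel σ₁ σ₂) n
      (frestrictLe (π := fun _ => V) n ω) {ω | ω (n + 1) = w} = stepDist σ₁ σ₂ n ω w := by
    rw [← PMF.toMeasure_apply_singleton _ _ (measurableSet_singleton w), ← stepKernel_frestrictLe,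
      ← h₁, Kernel.map_apply' _ (by fun_prop) _ (measurableSet_singleton w)]
    rfl
  change ∫ y, _ ∂_ = _
  rw [integral_indicator_one hm, measureReal_def, h₂]

/-- If `w` is chosen with probability at least `ε > 0` after every history ending in `u`, then
almost surely `w` occurs infinitely often if `u` does. -/
theorem ae_infOcc_of_le_nextDist (σ₁ : G.Strategy Owner.one) (σ₂ : G.Strategy Owner.two) (v : V)
    {u w : V} {ε : ℝ} (hε : 0 < ε) (h : ∀ h, ε ≤ (nextDist σ₁ σ₂ h u w).toReal) :
    ∀ᵐ ω ∂playMeasure σ₁ σ₂ v, u ∈ infOcc ω → w ∈ infOcc ω := by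
  -- Lévy's form: almost surely, `w` recurs iff the conditional probabilities of seeing `w` at time
  -- `k + 1`, given the play up to time `k`, have divergent sum.
  have hB := ae_mem_limsup_atTop_iff (ℱ := Filtration.piLE (X := fun _ : ℕ => V))
    (playMeasure σ₁ σ₂ v) (s := fun n => {ω | ω n = w}) (fun n => by
      refine ⟨{x | x ⟨n, Set.mem_Iic.2 le_rfl⟩ = w}, ?_, rfl⟩
      exact (measurable_pi_apply (X := fun _ : Set.Iic n => V) _) (measurableSet_singleton w))
  have hC := ae_all_iff.2 fun n => condExp_indicator_succ σ₁ σ₂ v n w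
  filter_upwards [hB, hC] with ω hBω hCω hu
  have hfr : ∃ᶠ n in atTop, ω n = u := frequently_atTop.2 hu
  have hlim : ω ∈ limsup (fun n => {ω : ℕ → V | ω n = w}) atTop := by
    rw [hBω]
    simp only [hCω]
    -- Summable terms would tend to `0`, yet they are at least `ε` at each of the infinitely many
    -- visits to `u`.
    rw [← not_summable_iff_tendsto_nat_atTop_of_nonneg fun k => ENNReal.toReal_nonneg]
    intro hs
    refine hfr ((hs.tendsto_atTop_zero.eventually (gt_mem_nhds hε)).mono fun n hn hnu => ?_)
    unfold stepDist at hn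
    rw [hnu] at hn
    exact hn.not_ge (h _)
  exact frequently_atTop.1
    ((mem_limsup_iff_frequently_mem (s := fun n => {ω : ℕ → V | ω n = w})).1 hlim)

end StochasticGame

/-! ### Selectors, the uniform strategy and recurrent sets of paths -/

namespace StochasticGame

open Filter Preorder

variable {V : Type*} [Fintype V] {G : StochasticGame V}

/-- The deterministic memoryless strategy that always moves along `f`. -/
noncomputable def Strategy.ofSelector {i : Owner} (f : V → V) (hf : ∀ u, f u ∈ G.post u) :
    G.Strategy i where
  act _ u := PMF.pure (f u)
  act_post h u w hw := by
    have : w = f u := by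
      by_contra hne
      simp [PMF.pure_apply, hne] at hw
    exact this ▸ hf u

theorem toFinset_post_nonempty (u : V) : (Set.toFinite (G.post u)).toFinset.Nonempty := by
  obtain ⟨w, hw⟩ := G.exists_succ u
  exact ⟨w, (Set.Finite.mem_toFinset _).2 hw⟩

variable (G) in
/-- The strategy that chooses all the successors with the same probability. -/
noncomputable def Strategy.uniform (i : Owner) : G.Strategy i where
  act _ u := PMF.uniformOfFinset _ (toFinset_post_nonempty (G := G) (u : V))
  act_post h u w hw := by
    have := (PMF.mem_support_uniformOfFinset_iff _ _).1
      ((PMF.mem_support_iff _ _).2 (pos_iff_ne_zero.1 hw))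
    simpa using this

theorem Strategy.isUniform_uniform (i : Owner) : (Strategy.uniform G i).IsUniform := by
  intro h u w hw
  change PMF.uniformOfFinset _ (toFinset_post_nonempty (G := G) (u : V)) w = _
  rw [PMF.uniformOfFinset_apply_of_mem (toFinset_post_nonempty (G := G) (u : V))
    ((Set.Finite.mem_toFinset _).2 hw), Set.ncard_eq_toFinset_card _]

theorem inv_ncard_post_ne_zero (u : V) : ((G.post u).ncard : ℝ≥0∞)⁻¹ ≠ 0 := by simp

theorem inv_ncard_post_ne_top (u : V) : ((G.post u).ncard : ℝ≥0∞)⁻¹ ≠ ⊤ := by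
  rw [ENNReal.inv_ne_top, Nat.cast_ne_zero]
  exact ((Set.ncard_pos).2 (G.exists_succ u)).ne'

/-- The moves of the game that remain possible when Player 1 always moves along `f`. -/
def SelectorStep (G : StochasticGame V) (f : V → V) (u w : V) : Prop :=
  w ∈ G.post u ∧ (G.owner u = Owner.one → w = f u)

/-- This turns positivity of probabilities into a question about a graph that does not depend on the
history. -/
theorem nextDist_ofSelector_ne_zero_iff {f : V → V} {hf : ∀ u, f u ∈ G.post u}
    {σ₂ : G.Strategy Owner.two} (hσ₂ : σ₂.IsUniform) (h : List V) (u w : V) :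
    nextDist (Strategy.ofSelector f hf) σ₂ h u w ≠ 0 ↔ G.SelectorStep f u w := by
  unfold SelectorStep
  match hu : G.owner u with
  | Owner.one =>
    rw [nextDist_one _ _ _ hu]
    change PMF.pure (f u) w ≠ 0 ↔ _
    by_cases hw : w = f u
    · simp [hw, hf]
    · simp [PMF.pure_apply, hw]
  | Owner.two =>
    refine ⟨fun hw => ⟨mem_post_of_nextDist_ne_zero hw, by simp⟩, fun hw => ?_⟩
    rw [nextDist_two _ _ _ hu, hσ₂ h ⟨u, hu⟩ w hw.1]
    exact inv_ncard_post_ne_zero u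
  | Owner.chance =>
    refine ⟨fun hw => ⟨mem_post_of_nextDist_ne_zero hw, by simp⟩, fun hw => ?_⟩
    rw [nextDist_chance_apply _ _ _ hu]
    exact (ENNReal.ofReal_pos.2 hw.1).ne'

/-- If Player 1 can keep the play in `C` and `C` can be reached from `v`, then some selector
both keeps the play in `C` and makes `C` reachable from `v`. -/
theorem exists_selector_reaching {C : Set V}
    (hC : ∀ u ∈ C, G.owner u = Owner.one → ∃ w ∈ C, w ∈ G.post u) {v c : V} (hc : c ∈ C)
    (hv : Relation.ReflTransGen (fun u w => w ∈ G.post u) v c) :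
    ∃ f : V → V, (∀ u, f u ∈ G.post u) ∧ (∀ u ∈ C, G.owner u = Owner.one → f u ∈ C) ∧
      ∃ c ∈ C, Relation.ReflTransGen (G.SelectorStep f) v c := by
  classical
  induction hv using Relation.ReflTransGen.head_induction_on with
  | refl =>
    have h : ∀ u, ∃ w, w ∈ G.post u ∧ (u ∈ C → G.owner u = Owner.one → w ∈ C) := by
      intro u
      by_cases hu : u ∈ C ∧ G.owner u = Owner.one
      · obtain ⟨w, hw, hwu⟩ := hC u hu.1 hu.2
        exact ⟨w, hwu, fun _ _ => hw⟩
      · obtain ⟨w, hw⟩ := G.exists_succ u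
        exact ⟨w, hw, fun h₁ h₂ => absurd ⟨h₁, h₂⟩ hu⟩
    choose f hf hfC using h
    exact ⟨f, hf, hfC, c, hc, .refl⟩
  | @head u w huw _ ih =>
    obtain ⟨f, hf, hfC, d, hd, hwd⟩ := ih
    -- If `u` already reaches `C` under `f`, then `f` is kept. Otherwise `u` lies neither in `C` nor
    -- on the path from `w`, so redirecting `f` at `u` to `w` spoils neither property.
    by_cases hu : ∃ d ∈ C, Relation.ReflTransGen (G.SelectorStep f) u d
    · exact ⟨f, hf, hfC, hu⟩
    refine ⟨Function.update f u w, fun x => ?_, fun x hx hx₁ => ?_, d, hd, ?_⟩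
    · rcases eq_or_ne x u with rfl | hxu
      · simpa using huw
      · simpa [hxu] using hf x
    · have hxu : x ≠ u := by
        rintro rfl
        exact hu ⟨x, hx, .refl⟩
      simpa [hxu] using hfC x hx hx₁
    · have h : ∀ x, Relation.ReflTransGen (G.SelectorStep f) x d →
          Relation.ReflTransGen (G.SelectorStep (Function.update f u w)) x d := by
        intro x hxd
        induction hxd using Relation.ReflTransGen.head_induction_on with
        | refl => exact .refl
        | @head x y hxy hyd ih =>
          have hxu : x ≠ u := by
            rintro rfl
            exact hu ⟨d, hd, .head hxy hyd⟩
          exact .head ⟨hxy.1, fun h => by simpa [hxu] using hxy.2 h⟩ ih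
      exact .head ⟨huw, fun _ => by simp⟩ (h w hwd)

theorem eq_of_mem_terminal {ω : ℕ → V} (hω : ω ∈ G.paths) {i : ℕ} (hi : ω i ∈ G.terminal)
    {j : ℕ} (hij : i ≤ j) : ω j = ω i := by
  induction j, hij using Nat.le_induction with
  | base => rfl
  | succ j _ ih =>
    by_contra hne
    have := hω j
    rw [ih, hi.2 _ hne] at this
    exact this.false

theorem reflTransGen_of_mem_paths {ω : ℕ → V} (hω : ω ∈ G.paths) (n : ℕ) :
    Relation.ReflTransGen (fun u w => w ∈ G.post u) (ω 0) (ω n) := by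
  induction n with
  | zero => exact .refl
  | succ n ih => exact ih.tail (hω n)

theorem infOcc_nonempty (ω : ℕ → V) : (infOcc ω).Nonempty := by
  have h : ∃ u, ∃ᶠ n in atTop, ω n = u := by
    by_contra! h
    obtain ⟨n, hn⟩ := (eventually_all.2 fun u => h u).exists
    exact hn (ω n) rfl
  obtain ⟨u, hu⟩ := h
  exact ⟨u, frequently_atTop.1 hu⟩

/-- Pigeonhole on the vertex following each visit to `u`. This is what is available at Player 1
vertices, where no fairness is assumed. -/
theorem exists_succ_mem_infOcc {ω : ℕ → V} (hω : ω ∈ G.paths) {u : V} (hu : u ∈ infOcc ω) :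
    ∃ w ∈ infOcc ω, w ∈ G.post u := by
  have h : ∃ w, ∃ᶠ n in atTop, ω n = u ∧ ω (n + 1) = w := by
    by_contra! h
    have hev := eventually_all.2 fun w => h w
    obtain ⟨n, hn, hnu⟩ := (hev.and_frequently (frequently_atTop.2 hu)).exists
    exact hn _ hnu rfl
  obtain ⟨w, hw⟩ := h
  refine ⟨w, fun n => ?_, ?_⟩
  · obtain ⟨m, hm, hmw⟩ := frequently_atTop.1 hw n
    exact ⟨m + 1, by omega, hmw.2⟩
  · obtain ⟨m, hmu, rfl⟩ := hw.exists
    rw [← hmu]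
    exact hω m

/-! ### Fairness, and positive probability of avoiding `T` -/

variable [MeasurableSpace V] [DiscreteMeasurableSpace V]

theorem measurable_mem_infOcc {V : Type*} [MeasurableSpace V] [DiscreteMeasurableSpace V] (u : V) : Measurable fun ω : ℕ → V => u ∈ infOcc ω :=
  Measurable.forall fun _ => Measurable.exists fun m => measurable_const.and
    ((Measurable.of_discrete (f := fun x : V => x = u)).comp (measurable_pi_apply m))

theorem measurableSet_fairPlays : MeasurableSet G.fairPlays := by
  refine measurableSet_setOfPred.2 (Measurable.and (Measurable.forall fun k => ?_)
    (Measurable.forall fun u => measurable_const.imp ((measurable_mem_infOcc u).imp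
      (Measurable.forall fun w => measurable_const.imp (measurable_mem_infOcc w)))))
  have h : Measurable fun ω : ℕ → V => (ω k, ω (k + 1)) := by fun_prop
  exact (Measurable.of_discrete (f := fun x : V × V => 0 < G.δ x.1 x.2)).comp h

theorem ae_infOcc_of_chance (σ₁ : G.Strategy Owner.one) (σ₂ : G.Strategy Owner.two) (v : V) :
    ∀ᵐ ω ∂playMeasure σ₁ σ₂ v, ∀ u, G.owner u = Owner.chance → u ∈ infOcc ω →
      G.post u ⊆ infOcc ω := by
  refine ae_all_iff.2 fun u => eventually_imp_distrib_left.2 fun hu => ?_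
  have h : ∀ᵐ ω ∂playMeasure σ₁ σ₂ v, ∀ w, w ∈ G.post u → u ∈ infOcc ω → w ∈ infOcc ω := by
    refine ae_all_iff.2 fun w => eventually_imp_distrib_left.2 fun hw => ?_
    -- The lower bound `ε` is `δ u w` itself.
    refine ae_infOcc_of_le_nextDist σ₁ σ₂ v hw fun h => ?_
    rw [nextDist_chance_apply _ _ _ hu, ENNReal.toReal_ofReal (G.δ_mem u w).1]
  filter_upwards [h] with ω hω huω w hw
  exact hω w hw huω

/-- The uniform strategy is fair. -/
theorem Strategy.IsUniform.isFair {σ₂ : G.Strategy Owner.two} (hσ₂ : σ₂.IsUniform) :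
    IsFair σ₂ := by
  intro σ₁ v
  rw [← mem_ae_iff_prob_eq_one measurableSet_fairPlays]
  have h : ∀ᵐ ω ∂playMeasure σ₁ σ₂ v, ∀ u w, G.owner u = Owner.two → w ∈ G.post u →
      u ∈ infOcc ω → w ∈ infOcc ω := by
    refine ae_all_iff.2 fun u => ae_all_iff.2 fun w => eventually_imp_distrib_left.2 fun hu =>
      eventually_imp_distrib_left.2 fun hw => ?_
    refine ae_infOcc_of_le_nextDist σ₁ σ₂ v
      (ENNReal.toReal_pos (inv_ncard_post_ne_zero (G := G) u) (inv_ncard_post_ne_top u))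
      fun h => ?_
    rw [nextDist_two _ _ _ hu, hσ₂ h ⟨u, hu⟩ w hw]
  filter_upwards [h, ae_mem_paths σ₁ σ₂ v] with ω hω hp
  exact ⟨hp, fun u hu huω w hw => hω u w hu hw huω⟩

theorem exists_playMeasure_ne_zero {f : V → V} {hf : ∀ u, f u ∈ G.post u}
    {σ₂ : G.Strategy Owner.two} (hσ₂ : σ₂.IsUniform) {v c : V}
    (hc : Relation.ReflTransGen (G.SelectorStep f) v c) :
    ∃ n, playMeasure (Strategy.ofSelector f hf) σ₂ v {ω | ω n = c} ≠ 0 := by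
  induction hc with
  | refl =>
    refine ⟨0, fun h => ?_⟩
    have h' : ∀ᵐ ω ∂playMeasure (Strategy.ofSelector f hf) σ₂ v, ω 0 ≠ v := by
      rw [ae_iff]
      simpa using h
    obtain ⟨ω, hω, hω'⟩ := (h'.and (ae_zero_eq _ _ v)).exists
    exact hω hω'
  | tail _ huw ih =>
    obtain ⟨n, hn⟩ := ih
    exact ⟨n + 1, playMeasure_succ_ne_zero _ _ v hn fun h =>
      (nextDist_ofSelector_ne_zero_iff hσ₂ h _ _).2 huw⟩

theorem playMeasure_eventually_terminal_lt_one {f : V → V} {hf : ∀ u, f u ∈ G.post u}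
    {σ₂ : G.Strategy Owner.two} (hσ₂ : σ₂.IsUniform) {C : Set V}
    (hC : ∀ u ∈ C, ∀ w, G.SelectorStep f u w → w ∈ C) (hCT : ∀ u ∈ C, u ∉ G.terminal)
    {v c : V} (hc : c ∈ C) (hvc : Relation.ReflTransGen (G.SelectorStep f) v c) :
    playMeasure (Strategy.ofSelector f hf) σ₂ v (G.eventually G.terminal) < 1 := by
  obtain ⟨n, hn⟩ := exists_playMeasure_ne_zero (hf := hf) hσ₂ hvc
  have hm : MeasurableSet {ω : ℕ → V | ω n = c} :=
    (measurable_pi_apply (X := fun _ : ℕ => V) n) (measurableSet_singleton c)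
  calc playMeasure (Strategy.ofSelector f hf) σ₂ v (G.eventually G.terminal)
      ≤ playMeasure (Strategy.ofSelector f hf) σ₂ v {ω | ω n = c}ᶜ := by
        -- A play at `c` at time `n` stays in `C` afterwards. Had it met a terminal vertex at any
        -- time `i`, it would still be there at time `max i n`, hence inside `C`.
        refine measure_mono_ae ?_
        filter_upwards [ae_stepDist_ne_zero (Strategy.ofSelector f hf) σ₂ v] with ω hω hT hnc
        obtain ⟨hp, i, hi⟩ := hT
        have hmem : ∀ m, n ≤ m → ω m ∈ C := by
          intro m hm
          induction m, hm using Nat.le_induction with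
          | base => exact hnc ▸ hc
          | succ m _ ih =>
            exact hC _ ih _ ((nextDist_ofSelector_ne_zero_iff hσ₂ _ _ _).1 (hω m))
        refine hCT _ (hmem (max i n) (le_max_right _ _)) ?_
        rw [eq_of_mem_terminal hp hi (le_max_left i n)]
        exact hi
    _ < 1 := by
        rw [prob_compl_eq_one_sub hm]
        exact ENNReal.sub_lt_self ENNReal.one_ne_top one_ne_zero hn

end StochasticGame

theorem mainTheorem11 {V : Type*} [Fintype V] [MeasurableSpace V] [DiscreteMeasurableSpace V]
    (G : StochasticGame V) (v : V)
    (h : ∃ (σ₁ : G.Strategy Owner.one) (σ₂ : G.Strategy Owner.two),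
      StochasticGame.IsFair σ₂ ∧
        StochasticGame.playMeasure σ₁ σ₂ v (G.eventually G.terminal) < 1) :
    ∃ (σ₁' : G.Strategy Owner.one) (σ₂' : G.Strategy Owner.two),
      σ₁'.IsMemoryless ∧ σ₁'.IsDeterministic ∧
        StochasticGame.IsFair σ₂' ∧ σ₂'.IsUniform ∧
          StochasticGame.playMeasure σ₁' σ₂' v (G.eventually G.terminal) < 1 := by
  open StochasticGame in
  obtain ⟨σ₁, σ₂, hfair, hlt⟩ := h
  have hfairPlays : ∀ᵐ ω ∂playMeasure σ₁ σ₂ v, ω ∈ G.fairPlays :=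
    (mem_ae_iff_prob_eq_one measurableSet_fairPlays).2 (hfair σ₁ v)
  have hT : ∃ᵐ ω ∂playMeasure σ₁ σ₂ v, ω ∉ G.eventually G.terminal := by
    intro hT
    refine hlt.not_ge ?_
    rw [← measure_univ (μ := playMeasure σ₁ σ₂ v)]
    refine measure_mono_ae ?_
    filter_upwards [hT] with ω hω _
    exact not_not.1 hω
  -- A positive-probability event meets every almost sure one, so one play has all the required
  -- properties at once.
  obtain ⟨ω, hωT, ⟨hp, htwo⟩, hchance, h0⟩ := (hT.and_eventually (hfairPlays.and
    ((ae_infOcc_of_chance σ₁ σ₂ v).and (ae_zero_eq σ₁ σ₂ v)))).exists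
  obtain ⟨c, hc⟩ := infOcc_nonempty ω
  obtain ⟨n, -, hn⟩ := hc 0
  obtain ⟨f, hf, hfC, d, hd, hvd⟩ := exists_selector_reaching (G := G) (C := infOcc ω)
    (fun u hu _ => exists_succ_mem_infOcc hp hu) hc (h0 ▸ hn ▸ reflTransGen_of_mem_paths hp n)
  have hunif := Strategy.isUniform_uniform (G := G) Owner.two
  refine ⟨Strategy.ofSelector f hf, Strategy.uniform G Owner.two, fun _ _ => rfl,
    fun _ u => ⟨f u, rfl⟩, hunif.isFair, hunif,
    playMeasure_eventually_terminal_lt_one hunif (fun u hu w huw => ?_) (fun u hu huT => ?_) hd hvd⟩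
  · match ho : G.owner u with
    | Owner.one => exact huw.2 ho ▸ hfC u hu ho
    | Owner.two => exact htwo u ho hu huw.1
    | Owner.chance => exact hchance u ho hu huw.1
  · obtain ⟨m, -, rfl⟩ := hu 0
    exact hωT ⟨hp, m, huT⟩
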